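/- Let $\pi:\mathcal V\to B$ be a real vector bundle of finite rank over a compact metric space $B$ (locally trivial, with linear coordinate changes and model fiber a finite-dimensional Hilbert space $H$), whose fibers carry an inner product depending continuously on the base point, with norm $\|\cdot\|$. Let $\Phi$ be a linear flow on $\mathcal V$, i.e. a continuous flow $\Phi:\mathbb R\times\mathcal V\to\mathcal V$ mapping fibers linearly into fibers. Let $\mathbb S\mathcal V=\{v\in\mathcal V: \|v\|=1\}$ with the flow $\mathbb S\Phi(t,v)=\Phi(t,v)/\|\Phi(t,v)\|$. On $\mathcal V^1=\mathcal V\times\mathbb R$ put $\|(v,r)\|=(\|v\|^2+r^2)^{1/2}$ and $\Phi^1(t,(v,r))=(\Phi(t,v),r)$; let $\mathbb S\mathcal V^1=\{p\in\mathcal V^1:\|p\|=1\}$ (the Poincaré sphere bundle) with the flow $\mathbb S\Phi^1(t,p)=\Phi^1(t,p)/\|\Phi^1(t,p)\|$, let $\overline{\mathbb S_P^+\mathcal V}=\{(v,r)\in\mathbb S\mathcal V^1: r\ge 0\}$ be its closed upper hemisphere, which is invariant, and let $\pi_P:\mathcal V\to\overline{\mathbb S_P^+\mathcal V}$, $\pi_P(v)=\frac{1}{\|(v,1)\|}(v,1)$.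 Fix metrics on $\mathbb S\mathcal V$ and on $\overline{\mathbb S_P^+\mathcal V}$ inducing their topologies. For a flow $\Psi$ on a metric space $X$ and $\varepsilon,T>0$, an $(\varepsilon,T)$-chain from $x$ to $y$ consists of an integer $n\ge1$, times $T_0,\dots,T_{n-1}\ge T$ and points $x=x_0,\dots,x_n=y$ of $X$ with $d(\Psi(T_i,x_i),x_{i+1})<\varepsilon$ for $i=0,\dots,n-1$. A set $M\subset X$ is chain transitive if for all $x,y\in M$ and all $\varepsilon,T>0$ there is an $(\varepsilon,T)$-chain in $X$ from $x$ to $y$; a chain recurrent component is a maximal chain transitive set. Let ${}_{\mathbb S}M_j$ be a chain recurrent component of $\mathbb S\Phi$ on $\mathbb S\mathcal V$ and $\mathcal V_j^+=\{\alpha v:\alpha>0,\ v\in{}_{\mathbb S}M_j\}$ the cone bundle generated by it. The growth rate of a chain $\zeta$ of $\mathbb S\Phi$ with times $T_i$ and points $v_i$ is $\lambda(\zeta)=\frac1\sigma\sum_{i=0}^{n-1}\bigl(\log\|\Phi(T_i,v_i)\|-\log\|v_i\|\bigr)$, $\sigma=\sum_{i=0}^{n-1}T_i$, and the Morse spectrum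 $\Sigma_{Mo}(\mathcal V_j^+)$ is the set of all $\lambda\in\mathbb R$ for which there are $\varepsilon^k\to0$, $T^k\to\infty$ (with $\varepsilon^k,T^k>0$) and $(\varepsilon^k,T^k)$-chains $\zeta^k$, all of whose points lie in ${}_{\mathbb S}M_j$, with $\lambda(\zeta^k)\to\lambda$. If $0\in\operatorname{int}\Sigma_{Mo}(\mathcal V_j^+)$, then the closure $\overline{\pi_P\mathcal V_j^+}$ is chain transitive for the flow $\mathbb S\Phi^1$ on the closed upper hemisphere $\overline{\mathbb S_P^+\mathcal V}$. -/

import Mathlib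

open Bundle Filter Topology

noncomputable section

namespace PoincareBundle

/-! ### Chains of a flow on a metric space -/

section Chains

/-- A metric on a topological space `X` which induces the given topology of `X`. -/
structure CompatibleMetric (X : Type*) [t : TopologicalSpace X] where
  /-- the metric -/
  metric : MetricSpace X
  /-- the metric induces the topology of `X` -/
  compatible : metric.toPseudoMetricSpace.toUniformSpace.toTopologicalSpace = t

/-- The distance of two points with respect to a compatible metric. -/
def CompatibleMetric.dist {X : Type*} [TopologicalSpace X] (d : CompatibleMetric X) (x y : X) : ℝ :=
  d.metric.dist x y

/-- An `(ε, T)`-chain of `ψ : ℝ → X → X`: an integer `n ≥ 1`, times `T_0, …, T_{n-1} ≥ T` and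
points `x_0, …, x_n` with `d (ψ (T_i, x_i), x_{i+1}) < ε` for `i < n`. Only the values `time i`
for `i < n` and `pt i` for `i ≤ n` matter. -/
structure Chain {X : Type*} [TopologicalSpace X] (d : CompatibleMetric X) (ψ : ℝ → X → X)
    (ε T : ℝ) where
  /-- the number of jumps -/
  n : ℕ
  n_pos : 0 < n
  /-- the times `T_i` -/
  time : ℕ → ℝ
  /-- the points `x_i` -/
  pt : ℕ → X
  time_ge : ∀ i < n, T ≤ time i
  jump : ∀ i < n, d.dist (ψ (time i) (pt i)) (pt (i + 1)) < ε

variable {X : Type*} [TopologicalSpace X] (d : CompatibleMetric X) (ψ : ℝ → X → X)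

/-- The (forward) chain limit set `Ω(x)`. -/
def chainLimitSet (x : X) : Set X :=
  {y | ∀ ε > 0, ∀ T > 0, ∃ ζ : Chain d ψ ε T, ζ.pt 0 = x ∧ ζ.pt ζ.n = y}

/-- A set `M` is chain transitive if `y ∈ Ω(x)` for all `x, y ∈ M`. -/
def IsChainTransitive (M : Set X) : Prop :=
  ∀ x ∈ M, ∀ y ∈ M, y ∈ chainLimitSet d ψ x

/-- A chain recurrent component is a maximal chain transitive set. -/
def IsChainRecurrentComponent (M : Set X) : Prop :=
  Maximal (IsChainTransitive d ψ) M

/-- The chain `ζ` lies in the set `M`. -/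
def Chain.InSet {d : CompatibleMetric X} {ψ : ℝ → X → X} {ε T : ℝ} (ζ : Chain d ψ ε T)
    (M : Set X) : Prop :=
  ∀ i ≤ ζ.n, ζ.pt i ∈ M

/-- The total time `σ = T_0 + ⋯ + T_{n-1}` of a chain. -/
def Chain.totalTime {d : CompatibleMetric X} {ψ : ℝ → X → X} {ε T : ℝ} (ζ : Chain d ψ ε T) : ℝ :=
  ∑ i ∈ Finset.range ζ.n, ζ.time i

end Chains

/-! ### Linear flows on vector bundles, the sphere bundle and the Poincaré sphere bundle -/

section LinearFlows

/-- A linear flow on a vector bundle: a continuous flow on the total space which maps each fiber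
linearly to a fiber. -/
structure LinearFlow {B : Type*} (F : Type*) (E : B → Type*) [TopologicalSpace (TotalSpace F E)]
    [∀ b, NormedAddCommGroup (E b)] [∀ b, InnerProductSpace ℝ (E b)] extends
    Flow ℝ (TotalSpace F E) where
  linear' : ∀ (t : ℝ) (b : B), ∃ (b' : B) (L : E b →ₗ[ℝ] E b'),
    ∀ v : E b, toFlow t (TotalSpace.mk b v) = TotalSpace.mk b' (L v)

variable {B : Type*} {F : Type*} {E : B → Type*} [TopologicalSpace (TotalSpace F E)]
  [∀ b, NormedAddCommGroup (E b)] [∀ b, InnerProductSpace ℝ (E b)]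

/-- The norm `‖v‖` of an element of the bundle, taken in its fiber. -/
def fiberNorm (v : TotalSpace F E) : ℝ := ‖v.snd‖

/-- Scalar multiplication in the fibers. -/
def scale (c : ℝ) (v : TotalSpace F E) : TotalSpace F E := TotalSpace.mk v.proj (c • v.snd)

lemma fiberNorm_scale (c : ℝ) (v : TotalSpace F E) :
    fiberNorm (scale c v) = |c| * fiberNorm v := by
  change ‖c • v.snd‖ = |c| * ‖v.snd‖
  rw [norm_smul, Real.norm_eq_abs]

/-- The norm `‖(v, r)‖ = (‖v‖² + r²)^(1/2)` on the extended bundle `𝒱¹ = 𝒱 × ℝ`. -/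
def extNorm (p : TotalSpace F E × ℝ) : ℝ := √(fiberNorm p.1 ^ 2 + p.2 ^ 2)

/-- Scalar multiplication in the fibers of `𝒱¹ = 𝒱 × ℝ`. -/
def extScale (c : ℝ) (p : TotalSpace F E × ℝ) : TotalSpace F E × ℝ := (scale c p.1, c * p.2)

lemma extNorm_extScale (c : ℝ) (p : TotalSpace F E × ℝ) :
    extNorm (extScale c p) = |c| * extNorm p := by
  have h : fiberNorm (scale c p.1) ^ 2 + (c * p.2) ^ 2
      = c ^ 2 * (fiberNorm p.1 ^ 2 + p.2 ^ 2) := by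
    rw [fiberNorm_scale, mul_pow, sq_abs]; ring
  simp only [extNorm, extScale]
  rw [h, Real.sqrt_mul (sq_nonneg c), Real.sqrt_sq_eq_abs]

variable (F E) in
/-- The unit sphere bundle `𝕊𝒱`, with the subspace topology. -/
abbrev SphereBundle : Type _ := {v : TotalSpace F E // fiberNorm v = 1}

variable (F E) in
/-- The closed upper hemisphere `{(v, r) ∈ 𝒱¹ | ‖(v, r)‖ = 1, r ≥ 0}` of the Poincaré sphere
bundle `𝕊𝒱¹`, with the subspace topology. It is the disjoint union of the open upper hemisphere
`r > 0` and of the equator `r = 0`. -/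
abbrev ClosedUpperHemisphere : Type _ :=
  {p : TotalSpace F E × ℝ // extNorm p = 1 ∧ 0 ≤ p.2}

lemma extNorm_one_pos (v : TotalSpace F E) : 0 < extNorm (v, (1 : ℝ)) :=
  Real.sqrt_pos.2 (by positivity)

/-- The projection `π_P v = (v / ‖(v, 1)‖, 1 / ‖(v, 1)‖)` of the bundle to the Poincaré sphere
bundle; its values lie in the upper hemisphere. -/
def poincareProj (v : TotalSpace F E) : ClosedUpperHemisphere F E :=
  ⟨extScale (extNorm (v, (1 : ℝ)))⁻¹ (v, 1), by
    have h := extNorm_one_pos v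
    rw [extNorm_extScale, abs_of_pos (inv_pos.2 h), inv_mul_cancel₀ h.ne'], by
    have h := extNorm_one_pos v
    simp only [extScale]
    positivity⟩

/-- The cone bundle `{α v | α > 0, v ∈ M}` generated by a subset `M` of the sphere bundle. -/
def coneBundle (M : Set (SphereBundle F E)) : Set (TotalSpace F E) :=
  {w | ∃ α : ℝ, 0 < α ∧ ∃ v ∈ M, w = scale α v.1}

namespace LinearFlow

variable (Φ : LinearFlow F E)

lemma fiberNorm_eq_zero_of (t : ℝ) (v : TotalSpace F E) (h : fiberNorm v = 0) :
    fiberNorm (Φ.toFlow t v) = 0 := by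
  obtain ⟨b, x⟩ := v
  obtain ⟨b', L, hL⟩ := Φ.linear' t b
  have hx : x = 0 := by simpa [fiberNorm] using h
  have hv : Φ.toFlow t ⟨b, x⟩ = ⟨b', L x⟩ := hL x
  rw [hv, hx]
  simp [fiberNorm]

lemma fiberNorm_pos (t : ℝ) (v : TotalSpace F E) (h : 0 < fiberNorm v) :
    0 < fiberNorm (Φ.toFlow t v) := by
  refine lt_of_le_of_ne (norm_nonneg _) fun h0 => h.ne' ?_
  have h1 := Φ.fiberNorm_eq_zero_of (-t) _ h0.symm
  rwa [← Φ.toFlow.map_add, neg_add_cancel, Φ.toFlow.map_zero_apply] at h1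

/-- The induced flow `𝕊Φ(t, v) = Φ(t, v) / ‖Φ(t, v)‖` on the sphere bundle. -/
def sphereFlow (t : ℝ) (v : SphereBundle F E) : SphereBundle F E :=
  ⟨scale (fiberNorm (Φ.toFlow t v.1))⁻¹ (Φ.toFlow t v.1), by
    have h : 0 < fiberNorm (Φ.toFlow t v.1) :=
      Φ.fiberNorm_pos t v.1 (v.2.symm ▸ one_pos)
    rw [fiberNorm_scale, abs_of_pos (inv_pos.2 h), inv_mul_cancel₀ h.ne']⟩

/-- The extended flow `Φ¹(t, (v, r)) = (Φ(t, v), r)` on `𝒱¹ = 𝒱 × ℝ`. -/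
def extFlow (t : ℝ) (p : TotalSpace F E × ℝ) : TotalSpace F E × ℝ := (Φ.toFlow t p.1, p.2)

lemma extNorm_extFlow_pos (t : ℝ) (p : ClosedUpperHemisphere F E) :
    0 < extNorm (Φ.extFlow t p.1) := by
  refine Real.sqrt_pos.2 ?_
  simp only [extFlow]
  have h0 : 0 ≤ fiberNorm p.1.1 := norm_nonneg _
  rcases h0.eq_or_lt with h | h
  · have h1 : p.1.2 ≠ 0 := fun h2 => by
      have h3 := p.2.1
      rw [extNorm, ← h, h2] at h3
      simp at h3
    positivity
  · have h1 := Φ.fiberNorm_pos t _ h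
    positivity

/-- The flow `𝕊Φ¹(t, p) = Φ¹(t, p) / ‖Φ¹(t, p)‖` on the closed upper hemisphere of the Poincaré
sphere bundle. -/
def hemisphereFlow (t : ℝ) (p : ClosedUpperHemisphere F E) : ClosedUpperHemisphere F E :=
  ⟨extScale (extNorm (Φ.extFlow t p.1))⁻¹ (Φ.extFlow t p.1), by
    have h := Φ.extNorm_extFlow_pos t p
    rw [extNorm_extScale, abs_of_pos (inv_pos.2 h), inv_mul_cancel₀ h.ne'],
    mul_nonneg (inv_nonneg.2 (Φ.extNorm_extFlow_pos t p).le) p.2.2⟩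

/-- The exponential growth rate
`λ(ζ) = σ⁻¹ ∑ (log ‖Φ(T_i, v_i)‖ - log ‖v_i‖)` of a chain of the flow on the sphere bundle. -/
def growthRate {d : CompatibleMetric (SphereBundle F E)} {ε T : ℝ}
    (ζ : Chain d Φ.sphereFlow ε T) : ℝ :=
  (1 / ζ.totalTime) * ∑ i ∈ Finset.range ζ.n,
    (Real.log (fiberNorm (Φ.toFlow (ζ.time i) (ζ.pt i).1)) - Real.log (fiberNorm (ζ.pt i).1))

/-- The Morse spectrum of the cone bundle generated by `M`: the limits of the growth rates of
`(ε^k, T^k)`-chains in `M` with `ε^k → 0` and `T^k → ∞`. -/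
def morseSpectrum (d : CompatibleMetric (SphereBundle F E)) (M : Set (SphereBundle F E)) :
    Set ℝ :=
  {l | ∃ (ε T : ℕ → ℝ) (ζ : ∀ k, Chain d Φ.sphereFlow (ε k) (T k)),
    (∀ k, 0 < ε k) ∧ (∀ k, 0 < T k) ∧ Tendsto ε atTop (𝓝 0) ∧ Tendsto T atTop atTop ∧
    (∀ k, (ζ k).InSet M) ∧ Tendsto (fun k => Φ.growthRate (ζ k)) atTop (𝓝 l)}

end LinearFlow

end LinearFlows

end PoincareBundle

end

open PoincareBundle

/-!
In polar coordinates `(v, s) ↦ π_P (exp s • v)`, with `v` in the sphere bundle and `s : ℝ`, the flow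
on the hemisphere is the skew product `(v, s) ↦ (𝕊Φ(t, v), s + log ‖Φ(t, v)‖)`: the second
coordinate of a chain records its growth. These coordinates are uniformly continuous
(`exists_dist_poincareProj_lt`), because they factor through the compact space of pairs consisting
of a unit vector and an angle in `[0, π / 2]`, and `arctan ∘ exp` is Lipschitz. So chains of the
skew product project to chains on the hemisphere. As the closure of a chain transitive set is chain
transitive (`IsChainTransitive.closure`), it remains to join any `(v, s)` to any `(w, s')`, with
`v, w ∈ M` and `s, s'` finite, by chains of the skew product.

Since `0` is interior to the Morse spectrum, the spectrum contains a positive and a negative number.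
Hence for given `ε, T` there are `(ε, T)`-chains in `M` of arbitrarily large positive and of
arbitrarily large negative growth (`LinearFlow.exists_skewReach_of_mem_morseSpectrum`). Chain
transitivity and compactness of the sphere bundle give `(ε, T)`-chains joining any two points of `M`
whose growth is bounded by a constant `C` depending only on `ε, T`
(`IsChainTransitive.exists_bound_skewReach`). They close the former chains up to loops at `v`, whose
growth keeps its sign. The growths of loops at `v`, with small jumps of the second coordinate
permitted, form an additive subsemigroup of `ℝ` that contains neighbourhoods of a positive and of a
negative number, so every real number is the growth of a loop (`forall_mem_of_add_mem`). A loop of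
suitable growth followed by a chain from `v` to `w` joins `(v, s)` to `(w, s')`.

Chains are handled as transitive closures of a one-step relation, which makes concatenation
immediate.
-/

noncomputable section

namespace PoincareBundle

/-! ### Compatible metrics -/

namespace CompatibleMetric

variable {X : Type*} [TopologicalSpace X] (d : CompatibleMetric X)

lemma dist_triangle (x y z : X) : d.dist x z ≤ d.dist x y + d.dist y z :=
  d.metric.dist_triangle x y z

lemma dist_self (x : X) : d.dist x x = 0 := d.metric.dist_self x

lemma setOf_dist_lt_mem_nhds (x : X) {ε : ℝ} (hε : 0 < ε) : {y | d.dist x y < ε} ∈ 𝓝 x := by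
  obtain ⟨m, rfl⟩ := d
  filter_upwards [Metric.ball_mem_nhds x hε] with y hy
  exact (_root_.dist_comm x y).trans_lt hy

lemma setOf_dist_lt_mem_nhds' (x : X) {ε : ℝ} (hε : 0 < ε) : {y | d.dist y x < ε} ∈ 𝓝 x := by
  obtain ⟨m, rfl⟩ := d
  exact Metric.ball_mem_nhds x hε

/-- Heine–Cantor for compatible metrics, on a product of compact spaces. -/
lemma exists_dist_lt_of_continuous [CompactSpace X] {Y Z : Type*} [MetricSpace Y] [CompactSpace Y]
    [TopologicalSpace Z] (e : CompatibleMetric Z) {f : X × Y → Z} (hf : Continuous f)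
    {ε : ℝ} (hε : 0 < ε) :
    ∃ δ > 0, ∀ x x' y y', d.dist x x' < δ → Dist.dist y y' < δ →
      e.dist (f (x, y)) (f (x', y')) < ε := by
  obtain ⟨m, rfl⟩ := d
  obtain ⟨m', rfl⟩ := e
  obtain ⟨δ, hδ, h⟩ :=
    Metric.uniformContinuous_iff.1 (CompactSpace.uniformContinuous_of_continuous hf) ε hε
  exact ⟨δ, hδ, fun x x' y y' hx hy => h (max_lt hx hy)⟩

end CompatibleMetric

/-! ### Chains as transitive closures -/

section Steps

variable {X : Type*} [TopologicalSpace X] (d : CompatibleMetric X) (ψ : ℝ → X → X)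

/-- One step of an `(ε, T)`-chain: `y` is reached from `x` by flowing for a time `t ≥ T`, followed
by a jump of size less than `ε`. -/
def ChainStep (ε T : ℝ) (x y : X) : Prop := ∃ t, T ≤ t ∧ d.dist (ψ t x) y < ε

variable {d ψ}

lemma ChainStep.mono {ε ε' T T' : ℝ} (hε : ε ≤ ε') (hT : T' ≤ T) {x y : X}
    (h : ChainStep d ψ ε T x y) : ChainStep d ψ ε' T' x y :=
  let ⟨t, ht, hd⟩ := h
  ⟨t, hT.trans ht, hd.trans_le hε⟩

lemma Chain.transGen {ε T : ℝ} (ζ : Chain d ψ ε T) :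
    Relation.TransGen (ChainStep d ψ ε T) (ζ.pt 0) (ζ.pt ζ.n) := by
  have key : ∀ i, i < ζ.n → Relation.TransGen (ChainStep d ψ ε T) (ζ.pt 0) (ζ.pt (i + 1)) := by
    intro i
    induction i with
    | zero => exact fun h => .single ⟨ζ.time 0, ζ.time_ge 0 h, ζ.jump 0 h⟩
    | succ i ih =>
      exact fun h => (ih (by omega)).tail ⟨ζ.time (i + 1), ζ.time_ge _ h, ζ.jump _ h⟩
  obtain ⟨m, hm⟩ := Nat.exists_eq_add_one.2 ζ.n_pos
  rw [hm]
  exact key m (by omega)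

lemma exists_chain_of_transGen {ε T : ℝ} {x y : X}
    (h : Relation.TransGen (ChainStep d ψ ε T) x y) :
    ∃ ζ : Chain d ψ ε T, ζ.pt 0 = x ∧ ζ.pt ζ.n = y := by
  induction h using Relation.TransGen.head_induction_on with
  | @single x h =>
    obtain ⟨t, ht, hd⟩ := h
    refine ⟨⟨1, one_pos, fun _ => t, fun i => i.casesOn x fun _ => y, fun _ _ => ht, ?_⟩, rfl, rfl⟩
    intro i hi
    obtain rfl : i = 0 := by omega
    exact hd
  | @head x z h _ ih =>
    obtain ⟨t, ht, hd⟩ := h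
    obtain ⟨ζ, rfl, rfl⟩ := ih
    refine ⟨⟨ζ.n + 1, Nat.succ_pos _, fun i => i.casesOn t ζ.time, fun i => i.casesOn x ζ.pt,
      ?_, ?_⟩, rfl, rfl⟩
    · rintro (_ | i) hi
      exacts [ht, ζ.time_ge i (by omega)]
    · rintro (_ | i) hi
      exacts [hd, ζ.jump i (by omega)]

lemma mem_chainLimitSet_iff {x y : X} :
    y ∈ chainLimitSet d ψ x ↔
      ∀ ε > 0, ∀ T > 0, Relation.TransGen (ChainStep d ψ ε T) x y := by
  refine forall₄_congr fun ε _ T _ => ⟨?_, exists_chain_of_transGen⟩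
  rintro ⟨ζ, rfl, rfl⟩
  exact ζ.transGen

/-- The closure of a chain transitive set is chain transitive. A chain from a point near `x` need
not be a chain from `x`, as its first time depends on that point; so the first step, taken with
times at least `2 T`, is split at time `T`, where continuity of `ψ T` applies. -/
lemma IsChainTransitive.closure (hψ : ∀ t, Continuous (ψ t))
    (hadd : ∀ s t x, ψ (s + t) x = ψ s (ψ t x)) {M : Set X} (hM : IsChainTransitive d ψ M) :
    IsChainTransitive d ψ (closure M) := by
  intro x hx y hy
  rw [mem_chainLimitSet_iff]
  intro ε hε T hT
  obtain ⟨y', hy', hyM⟩ := mem_closure_iff_nhds.1 hy _ (d.setOf_dist_lt_mem_nhds' y (half_pos hε))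
  obtain ⟨x', hx', hxM⟩ := mem_closure_iff_nhds.1 hx _
    ((hψ T).continuousAt.preimage_mem_nhds (d.setOf_dist_lt_mem_nhds (ψ T x) hε))
  obtain ⟨z, hz, t, ht, hd⟩ := Relation.TransGen.tail'_iff.1
    (mem_chainLimitSet_iff.1 (hM x' hxM y' hyM) (ε / 2) (half_pos hε) (2 * T) (by positivity))
  have hlast : ChainStep d ψ ε (2 * T) z y := by
    refine ⟨t, ht, (d.dist_triangle _ y' _).trans_lt ?_⟩
    have : d.dist y' y < ε / 2 := hy'
    linarith
  obtain ⟨w, ⟨t', ht', hd'⟩, hw⟩ := Relation.TransGen.head'_iff.1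
    (Relation.TransGen.tail'
      (Relation.ReflTransGen.mono (fun _ _ h => h.mono (by linarith) le_rfl) _ _ hz) hlast)
  refine .head ⟨T, le_rfl, hx'⟩ (.head' (b := w) ⟨t' - T, by linarith, ?_⟩
    (Relation.ReflTransGen.mono (fun _ _ h => h.mono le_rfl (by linarith)) _ _ hw))
  rwa [← hadd, sub_add_cancel]

end Steps

/-! ### Chains of a skew product over a chain transitive set -/

/-- An additive subsemigroup of `ℝ` which contains a neighbourhood of a positive and of a negative
number is all of `ℝ`. -/
lemma forall_mem_of_add_mem {A : Set ℝ} (hadd : ∀ a ∈ A, ∀ b ∈ A, a + b ∈ A) {p q η : ℝ}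
    (hp : 0 < p) (hq : q < 0) (hη : 0 < η) (hpA : ∀ e, |e| ≤ η → p + e ∈ A) (hqA : q ∈ A) (t : ℝ) :
    t ∈ A := by
  have hmul : ∀ a ∈ A, ∀ n : ℕ, (n + 1 : ℝ) * a ∈ A := by
    intro a ha n
    induction n with
    | zero => simpa using ha
    | succ n ih =>
      have := hadd _ ih _ ha
      push_cast
      convert this using 1
      ring
  obtain ⟨n, hn⟩ := exists_nat_gt (max (-q / η) ((t - q) / p))
  have h1 : -q < (n + 1) * η := by
    have := (div_lt_iff₀ hη).1 ((le_max_left _ _).trans_lt hn)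
    linarith
  have h2 : t - q < (n + 1) * p := by
    have := (div_lt_iff₀ hp).1 ((le_max_right _ _).trans_lt hn)
    linarith
  -- `m + 1` negative steps bring `(n + 1) p` as close as possible to `t` from above; the error is
  -- then distributed evenly over the `n + 1` positive steps.
  set m := ⌊((n + 1) * p - t + q) / (-q)⌋₊ with hm
  have hm1 : (m : ℝ) * (-q) ≤ (n + 1) * p - t + q :=
    (le_div_iff₀ (by linarith)).1 (Nat.floor_le (div_nonneg (by linarith) (by linarith)))
  have hm2 : (n + 1) * p - t + q < (m + 1) * (-q) :=
    (div_lt_iff₀ (by linarith)).1 (Nat.lt_floor_add_one _)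
  have hn0 : (0 : ℝ) < n + 1 := by positivity
  have hpos := hmul _ (hpA ((t - (n + 1) * p - (m + 1) * q) / (n + 1)) (by
    rw [abs_div, abs_of_pos hn0, div_le_iff₀ hn0, abs_le]
    constructor <;> nlinarith)) n
  convert hadd _ hpos _ (hmul q hqA m) using 1
  field_simp
  ring

section Skew

variable {X : Type*} [TopologicalSpace X] (d : CompatibleMetric X) (ψ : ℝ → X → X)
  (c : ℝ → X → ℝ)

/-- One step of a chain of the skew product `(x, s) ↦ (ψ t x, s + c t x)` on `X × ℝ`, with jumps
less than `ε` in `X` and at most `η` in `ℝ`. For `η = 0`, the second coordinate records the total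
growth, measured by `c`, along a chain in `X`. -/
def SkewStep (ε T η : ℝ) (p q : X × ℝ) : Prop :=
  ∃ t, T ≤ t ∧ d.dist (ψ t p.1) q.1 < ε ∧ |q.2 - (p.2 + c t p.1)| ≤ η

/-- The skew product has chains with jumps `< ε` in `X` and `≤ η` in `ℝ`, and times `≥ T`, from `x`
to `y` along which the second coordinate increases by `a`. -/
def SkewReach (ε T η : ℝ) (x y : X) (a : ℝ) : Prop :=
  ∀ s, Relation.TransGen (SkewStep d ψ c ε T η) (x, s) (y, s + a)

variable {d ψ c}

lemma SkewStep.mono {ε ε' T T' η η' : ℝ} (hε : ε ≤ ε') (hT : T' ≤ T) (hη : η ≤ η') {p q : X × ℝ}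
    (h : SkewStep d ψ c ε T η p q) : SkewStep d ψ c ε' T' η' p q :=
  let ⟨t, ht, hd, ha⟩ := h
  ⟨t, hT.trans ht, hd.trans_le hε, ha.trans hη⟩

lemma SkewReach.mono {ε ε' T T' η η' : ℝ} (hε : ε ≤ ε') (hT : T' ≤ T) (hη : η ≤ η') {x y : X}
    {a : ℝ} (h : SkewReach d ψ c ε T η x y a) : SkewReach d ψ c ε' T' η' x y a :=
  fun s => Relation.TransGen.mono (fun _ _ h => h.mono hε hT hη) _ _ (h s)

lemma SkewReach.trans {ε T η : ℝ} {x y z : X} {a b : ℝ} (h : SkewReach d ψ c ε T η x y a)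
    (h' : SkewReach d ψ c ε T η y z b) : SkewReach d ψ c ε T η x z (a + b) :=
  fun s => (h s).trans (by rw [← add_assoc]; exact h' (s + a))

lemma skewReach_of_transGen {ε T η : ℝ} {p q : X × ℝ}
    (h : Relation.TransGen (SkewStep d ψ c ε T η) p q) :
    SkewReach d ψ c ε T η p.1 q.1 (q.2 - p.2) := by
  intro s
  have hle : SkewStep d ψ c ε T η ≤
      Function.onFun (SkewStep d ψ c ε T η) fun z : X × ℝ => (z.1, z.2 + (s - p.2)) :=
    fun z w ⟨t, ht, hd, ha⟩ => ⟨t, ht, hd, by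
      dsimp only
      rwa [show w.2 + (s - p.2) - (z.2 + (s - p.2) + c t z.1) = w.2 - (z.2 + c t z.1) by ring]⟩
  have := Relation.TransGen.lift _ hle _ _ h
  simp only [Function.onFun] at this
  convert this using 2 <;> ring

lemma exists_skewReach_of_transGen {ε T : ℝ} {x y : X}
    (h : Relation.TransGen (ChainStep d ψ ε T) x y) : ∃ a, SkewReach d ψ c ε T 0 x y a := by
  have hstep : ∀ {u v}, ChainStep d ψ ε T u v → ∃ a, SkewReach d ψ c ε T 0 u v a :=
    fun {u v} ⟨t, ht, hd⟩ => ⟨c t u, fun s => .single ⟨t, ht, hd, by simp⟩⟩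
  induction h with
  | single h => exact hstep h
  | tail _ h ih =>
    obtain ⟨a, ha⟩ := ih
    obtain ⟨b, hb⟩ := hstep h
    exact ⟨a + b, ha.trans hb⟩

/-- The last jump of an exact chain may be moved, by at most `δ` in `X` and at most `η` in `ℝ`. -/
lemma SkewReach.move_end {ε T δ η : ℝ} {x y y' : X} {a e : ℝ} (h : SkewReach d ψ c ε T 0 x y a)
    (hδ : 0 ≤ δ) (hy : d.dist y y' ≤ δ) (he : |e| ≤ η) :
    SkewReach d ψ c (ε + δ) T η x y' (a + e) := by
  intro s
  obtain ⟨z, hz, t, ht, hd, ha⟩ := Relation.TransGen.tail'_iff.1 (h s)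
  have hη : 0 ≤ η := (abs_nonneg e).trans he
  refine .tail' (Relation.ReflTransGen.mono (fun _ _ h => h.mono (by linarith) le_rfl hη) _ _ hz)
    ⟨t, ht, ?_, ?_⟩
  · exact (d.dist_triangle _ y _).trans_lt (by dsimp only at hd; linarith)
  · have h0 : s + a - (z.2 + c t z.1) = 0 := abs_nonpos_iff.1 ha
    dsimp only
    rwa [show s + (a + e) - (z.2 + c t z.1) = e by linarith]

/-- The initial point of an exact chain may be moved a little, at the cost of a jump and of the
change of the growth along the first step. -/
lemma SkewReach.move_start {ε T δ : ℝ} {x y : X} {a : ℝ} (hψ : ∀ t, Continuous (ψ t))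
    (hc : ∀ t, Continuous (c t)) (h : SkewReach d ψ c ε T 0 x y a) (hδ : 0 < δ) :
    ∀ᶠ x' in 𝓝 x, ∃ a', |a'| ≤ |a| + 1 ∧ SkewReach d ψ c (ε + δ) T 0 x' y a' := by
  obtain ⟨z, ⟨t, ht, hd, ha⟩, hz⟩ := Relation.TransGen.head'_iff.1 (h 0)
  have h1 := (hψ t).continuousAt.eventually (d.setOf_dist_lt_mem_nhds' (ψ t x) hδ)
  have h2 := (hc t).continuousAt.eventually (Metric.ball_mem_nhds (c t x) one_pos)
  filter_upwards [h1, h2] with x' hx' hcx'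
  refine ⟨a + (c t x' - c t x), (abs_add_le _ _).trans (by
    have : |c t x' - c t x| < 1 := hcx'
    linarith), ?_⟩
  have h0 : z.2 - (0 + c t x) = 0 := abs_nonpos_iff.1 ha
  have hfirst : SkewStep d ψ c (ε + δ) T 0 (x', c t x - c t x') z := by
    refine ⟨t, ht, (d.dist_triangle _ (ψ t x) _).trans_lt ?_, ?_⟩
    · have h3 : d.dist (ψ t x') (ψ t x) < δ := hx'
      dsimp only at hd
      linarith
    · rw [abs_nonpos_iff]
      dsimp only
      linarith
  convert skewReach_of_transGen
    (.head' hfirst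
      (Relation.ReflTransGen.mono (fun _ _ h => h.mono (by linarith) le_rfl le_rfl) _ _ hz)) using 1
  ring

/-- Over a compact space, points of a chain transitive set are joined by `(ε, T)`-chains of
uniformly bounded growth. -/
lemma IsChainTransitive.exists_bound_skewReach [CompactSpace X] (hψ : ∀ t, Continuous (ψ t))
    (hadd : ∀ s t x, ψ (s + t) x = ψ s (ψ t x)) (hc : ∀ t, Continuous (c t)) {M : Set X}
    (hM : IsChainTransitive d ψ M) {ε T : ℝ} (hε : 0 < ε) (hT : 0 < T) :
    ∃ C, ∀ x ∈ M, ∀ y ∈ M, ∃ a, |a| ≤ C ∧ SkewReach d ψ c ε T 0 x y a := by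
  have hcomp : IsCompact (_root_.closure M ×ˢ _root_.closure M) :=
    isClosed_closure.isCompact.prod isClosed_closure.isCompact
  suffices h : ∃ C, ∀ z ∈ _root_.closure M ×ˢ _root_.closure M,
      ∃ a, |a| ≤ C ∧ SkewReach d ψ c ε T 0 z.1 z.2 a by
    obtain ⟨C, hC⟩ := h
    exact ⟨C, fun x hx y hy => hC (x, y) ⟨subset_closure hx, subset_closure hy⟩⟩
  refine hcomp.induction_on
    (p := fun K => ∃ C, ∀ z ∈ K, ∃ a, |a| ≤ C ∧ SkewReach d ψ c ε T 0 z.1 z.2 a)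
    ⟨0, by simp⟩ ?_ ?_ ?_
  · rintro K L hKL ⟨C, hC⟩
    exact ⟨C, fun z hz => hC z (hKL hz)⟩
  · rintro K L ⟨C, hC⟩ ⟨D, hD⟩
    refine ⟨max C D, ?_⟩
    rintro z (hz | hz)
    · obtain ⟨a, ha, h⟩ := hC z hz
      exact ⟨a, ha.trans (le_max_left _ _), h⟩
    · obtain ⟨a, ha, h⟩ := hD z hz
      exact ⟨a, ha.trans (le_max_right _ _), h⟩
  · rintro ⟨x, y⟩ ⟨hx, hy⟩
    obtain ⟨a, ha⟩ := exists_skewReach_of_transGen (c := c)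
      (mem_chainLimitSet_iff.1 (hM.closure hψ hadd x hx y hy) (ε / 3) (by positivity) T hT)
    refine ⟨_, mem_nhdsWithin_of_mem_nhds (prod_mem_nhds
      (ha.move_start hψ hc (δ := ε / 3) (by positivity))
      (d.setOf_dist_lt_mem_nhds y (ε := ε / 3) (by positivity))), |a| + 1, ?_⟩
    rintro ⟨x', y'⟩ ⟨⟨a', ha', h'⟩, hy'⟩
    refine ⟨a', ha', ?_⟩
    have := h'.move_end (η := 0) (e := 0) (by positivity) (le_of_lt hy') (by simp)
    rw [add_zero] at this
    exact this.mono (by linarith) le_rfl le_rfl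

/-- If a chain transitive set contains the ends of chains of arbitrarily large and of arbitrarily
negative growth, then any growth is realised between any two of its points, up to jumps in the
second coordinate. -/
lemma IsChainTransitive.skewReach [CompactSpace X] (hψ : ∀ t, Continuous (ψ t))
    (hadd : ∀ s t x, ψ (s + t) x = ψ s (ψ t x)) (hc : ∀ t, Continuous (c t)) {M : Set X}
    (hM : IsChainTransitive d ψ M) {ε T η : ℝ} (hε : 0 < ε) (hT : 0 < T) (hη : 0 < η)
    (hpos : ∀ R, ∃ u ∈ M, ∃ u' ∈ M, ∃ a ≥ R, SkewReach d ψ c ε T 0 u u' a)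
    (hneg : ∀ R, ∃ u ∈ M, ∃ u' ∈ M, ∃ a ≤ R, SkewReach d ψ c ε T 0 u u' a)
    {x y : X} (hx : x ∈ M) (hy : y ∈ M) (a : ℝ) : SkewReach d ψ c ε T η x y a := by
  obtain ⟨C, hC⟩ := hM.exists_bound_skewReach hψ hadd hc hε hT
  have loop : ∀ u ∈ M, ∀ u' ∈ M, ∀ b, SkewReach d ψ c ε T 0 u u' b →
      ∃ b', |b' - b| ≤ 2 * C ∧ SkewReach d ψ c ε T 0 x x b' := by
    intro u hu u' hu' b hb
    obtain ⟨a₁, h₁, h₁'⟩ := hC x hx u hu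
    obtain ⟨a₂, h₂, h₂'⟩ := hC u' hu' x hx
    refine ⟨a₁ + b + a₂, ?_, (h₁'.trans hb).trans h₂'⟩
    rw [show a₁ + b + a₂ - b = a₁ + a₂ by ring]
    exact (abs_add_le _ _).trans (by linarith)
  obtain ⟨u, hu, u', hu', b, hb, hub⟩ := hpos (2 * C + 1)
  obtain ⟨p, hp, hpx⟩ := loop u hu u' hu' b hub
  obtain ⟨v, hv, v', hv', b', hb', hvb⟩ := hneg (-(2 * C + 1))
  obtain ⟨q, hq, hqx⟩ := loop v hv v' hv' b' hvb
  rw [abs_le] at hp hq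
  obtain ⟨g, -, hg⟩ := hC x hx y hy
  have hloop : SkewReach d ψ c ε T η x x (a - g) :=
    forall_mem_of_add_mem (A := {b | SkewReach d ψ c ε T η x x b})
      (fun _ h _ h' => h.trans h') (by linarith : 0 < p) (by linarith : q < 0) hη
      (fun e he => by simpa using hpx.move_end le_rfl (d.dist_self x).le he)
      (hqx.mono le_rfl le_rfl hη.le) (a - g)
  simpa using hloop.trans (hg.mono le_rfl le_rfl hη.le)

/-- Along a chain, the second coordinate of the skew product increases by the total growth. -/
lemma Chain.skewReach {ε T : ℝ} (ζ : Chain d ψ ε T) :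
    SkewReach d ψ c ε T 0 (ζ.pt 0) (ζ.pt ζ.n)
      (∑ i ∈ Finset.range ζ.n, c (ζ.time i) (ζ.pt i)) := by
  have step : ∀ i < ζ.n,
      SkewReach d ψ c ε T 0 (ζ.pt i) (ζ.pt (i + 1)) (c (ζ.time i) (ζ.pt i)) :=
    fun i hi s => .single ⟨ζ.time i, ζ.time_ge i hi, ζ.jump i hi, by simp⟩
  have key : ∀ i, i < ζ.n → SkewReach d ψ c ε T 0 (ζ.pt 0) (ζ.pt (i + 1))
      (∑ j ∈ Finset.range (i + 1), c (ζ.time j) (ζ.pt j)) := by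
    intro i
    induction i with
    | zero => intro h; simpa using step 0 h
    | succ i ih =>
      intro h
      rw [Finset.sum_range_succ]
      exact (ih (by omega)).trans (step _ h)
  obtain ⟨m, hm⟩ := Nat.exists_eq_add_one.2 ζ.n_pos
  rw [hm]
  exact key m (by omega)

end Skew

/-! ### Topology of the sphere bundle and of the hemisphere -/

section Bundle

variable {B : Type*} [TopologicalSpace B]
  {F : Type*} [NormedAddCommGroup F] [InnerProductSpace ℝ F]
  {E : B → Type*} [TopologicalSpace (TotalSpace F E)]
  [∀ b, NormedAddCommGroup (E b)] [∀ b, InnerProductSpace ℝ (E b)]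
  [FiberBundle F E] [VectorBundle ℝ F E]

lemma continuous_scale {Y : Type*} [TopologicalSpace Y] {a : Y → ℝ} {f : Y → TotalSpace F E}
    (ha : Continuous a) (hf : Continuous f) : Continuous fun y => scale (a y) (f y) := by
  rw [continuous_iff_continuousAt]
  intro y
  obtain ⟨h1, h2⟩ := (FiberBundle.continuousAt_totalSpace F f).1 hf.continuousAt
  refine (FiberBundle.continuousAt_totalSpace F _).2 ⟨h1, ?_⟩
  refine (ha.continuousAt.smul h2).congr ?_
  set e := trivializationAt F E (f y).proj
  filter_upwards [h1.eventually (e.open_baseSet.mem_nhds (mem_baseSet_trivializationAt F E _))]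
    with z hz
  exact ((e.linear ℝ hz).map_smul (a z) (f z).snd).symm

lemma continuous_extScale {Y : Type*} [TopologicalSpace Y] {a : Y → ℝ}
    {f : Y → TotalSpace F E × ℝ} (ha : Continuous a) (hf : Continuous f) :
    Continuous fun y => extScale (a y) (f y) :=
  (continuous_scale ha hf.fst).prodMk (ha.mul hf.snd)

variable [IsContinuousRiemannianBundle F E]

variable (F E) in
lemma continuous_fiberNorm : Continuous (fiberNorm : TotalSpace F E → ℝ) := by
  have h : Continuous fun v : TotalSpace F E => inner ℝ v.snd v.snd :=
    Continuous.inner_bundle (b := fun v : TotalSpace F E => v.proj) (v := fun v => v.snd)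
      (w := fun v => v.snd) continuous_id continuous_id
  refine h.sqrt.congr fun v => ?_
  rw [real_inner_self_eq_norm_sq, Real.sqrt_sq (norm_nonneg _)]
  rfl

variable (F E) in
lemma continuous_extNorm : Continuous (extNorm : TotalSpace F E × ℝ → ℝ) :=
  ((((continuous_fiberNorm F E).comp continuous_fst).pow 2).add (continuous_snd.pow 2)).sqrt

/-- The unit sphere bundle over a compact base is compact: near each base point, the
trivialization maps unit vectors into a bounded subset of the finite-dimensional model fiber. -/
instance [CompactSpace B] [FiniteDimensional ℝ F] : CompactSpace (SphereBundle F E) := by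
  suffices h : IsCompact {v : TotalSpace F E | fiberNorm v = 1} from
    isCompact_iff_compactSpace.1 h
  refine isCompact_iff_ultrafilter_le_nhds.2 ?_
  intro f hf
  rw [le_principal_iff] at hf
  obtain ⟨b, -, hb⟩ := isCompact_univ.ultrafilter_le_nhds (f.map (TotalSpace.proj (F := F) (E := E)))
    (by simp)
  have hb' : Tendsto (TotalSpace.proj (F := F) (E := E)) f (𝓝 b) := hb
  set e := trivializationAt F E b
  have hbe : b ∈ e.baseSet := mem_baseSet_trivializationAt F E b
  obtain ⟨C, -, hC⟩ := eventually_norm_trivializationAt_lt F E b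
  have hball : ∀ᶠ v in (f : Filter (TotalSpace F E)), (e v).2 ∈ Metric.closedBall (0 : F) C := by
    filter_upwards [hf, hb'.eventually hC, hb'.eventually (e.open_baseSet.mem_nhds hbe)]
      with v hv hv' hve
    have h1 := (e.continuousLinearMapAt ℝ v.proj).le_opNorm v.snd
    rw [Trivialization.continuousLinearMapAt_apply_of_mem ℝ e hve] at h1
    have h2 : ‖v.snd‖ = 1 := hv
    rw [h2, mul_one] at h1
    rw [mem_closedBall_zero_iff]
    exact h1.trans hv'.le
  have : ProperSpace F := FiniteDimensional.proper_real F
  obtain ⟨y, -, hy⟩ := (isCompact_closedBall (0 : F) C).ultrafilter_le_nhds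
    (f.map fun v => (e v).2) (by rw [le_principal_iff]; exact hball)
  have hmem : (b, y) ∈ e.target := e.mem_target.2 hbe
  set z := e.toOpenPartialHomeomorph.symm (b, y)
  have hz : z ∈ e.source := e.map_target hmem
  have hzproj : z.proj = b := e.proj_symm_apply hmem
  have hze : e z = (b, y) := e.apply_symm_apply hmem
  have hfz : (f : Filter (TotalSpace F E)) ≤ 𝓝 z :=
    (e.tendsto_nhds_iff (f := id) hz).2 ⟨by rw [hzproj]; exact hb', by rw [hze]; exact hy⟩
  have hclosed : IsClosed {v : TotalSpace F E | fiberNorm v = 1} :=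
    isClosed_eq (continuous_fiberNorm F E) continuous_const
  exact ⟨z, hclosed.mem_of_frequently_of_tendsto (f := id)
    (Filter.Eventually.frequently (f := (f : Filter (TotalSpace F E))) hf) hfz, hfz⟩

end Bundle

/-! ### The induced flows -/

section Flows

variable {B : Type*} {F : Type*} {E : B → Type*} [TopologicalSpace (TotalSpace F E)]
  [∀ b, NormedAddCommGroup (E b)] [∀ b, InnerProductSpace ℝ (E b)]

omit [TopologicalSpace (TotalSpace F E)] in
lemma scale_scale (a b : ℝ) (v : TotalSpace F E) : scale a (scale b v) = scale (a * b) v :=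
  congrArg (TotalSpace.mk v.proj) (mul_smul a b v.snd).symm

omit [TopologicalSpace (TotalSpace F E)] in
lemma extScale_extScale (a b : ℝ) (p : TotalSpace F E × ℝ) :
    extScale a (extScale b p) = extScale (a * b) p := by
  simp [extScale, scale_scale, mul_assoc]

/-- Normalizing a vector of the bundle does not see positive factors. -/
lemma scale_inv_fiberNorm_scale {a : ℝ} (ha : 0 < a) (v : TotalSpace F E) :
    scale (fiberNorm (scale a v))⁻¹ (scale a v) = scale (fiberNorm v)⁻¹ v := by
  rw [fiberNorm_scale, scale_scale, abs_of_pos ha, mul_inv, mul_comm a⁻¹,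
    inv_mul_cancel_right₀ ha.ne']

/-- Normalizing a vector of the extended bundle does not see positive factors. -/
lemma extScale_inv_extNorm_extScale {a : ℝ} (ha : 0 < a) (p : TotalSpace F E × ℝ) :
    extScale (extNorm (extScale a p))⁻¹ (extScale a p) = extScale (extNorm p)⁻¹ p := by
  rw [extNorm_extScale, extScale_extScale, abs_of_pos ha, mul_inv, mul_comm a⁻¹,
    inv_mul_cancel_right₀ ha.ne']

namespace LinearFlow

variable (Φ : LinearFlow F E)

lemma map_scale (t c : ℝ) (v : TotalSpace F E) :
    Φ.toFlow t (scale c v) = scale c (Φ.toFlow t v) := by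
  obtain ⟨b, x⟩ := v
  obtain ⟨b', L, hL⟩ := Φ.linear' t b
  calc Φ.toFlow t (scale c ⟨b, x⟩) = ⟨b', L (c • x)⟩ := hL (c • x)
    _ = scale c ⟨b', L x⟩ := by rw [map_smul]; rfl
    _ = scale c (Φ.toFlow t ⟨b, x⟩) := by rw [← hL x]

lemma extFlow_extScale (t c : ℝ) (p : TotalSpace F E × ℝ) :
    Φ.extFlow t (extScale c p) = extScale c (Φ.extFlow t p) := by
  simp [extFlow, extScale, map_scale]

lemma sphereFlow_add (s t : ℝ) (v : SphereBundle F E) :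
    Φ.sphereFlow (s + t) v = Φ.sphereFlow s (Φ.sphereFlow t v) := by
  have h : 0 < fiberNorm (Φ.toFlow t v.1) := Φ.fiberNorm_pos t v.1 (v.2.symm ▸ one_pos)
  apply Subtype.ext
  simp only [sphereFlow]
  rw [Φ.map_scale, scale_inv_fiberNorm_scale (inv_pos.2 h), Φ.toFlow.map_add]

lemma hemisphereFlow_add (s t : ℝ) (p : ClosedUpperHemisphere F E) :
    Φ.hemisphereFlow (s + t) p = Φ.hemisphereFlow s (Φ.hemisphereFlow t p) := by
  apply Subtype.ext
  simp only [hemisphereFlow]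
  rw [Φ.extFlow_extScale, extScale_inv_extNorm_extScale (inv_pos.2 (Φ.extNorm_extFlow_pos t p))]
  simp [extFlow, Φ.toFlow.map_add]

/-- The Poincaré projection conjugates the linear flow to the flow on the hemisphere. -/
lemma hemisphereFlow_poincareProj (t : ℝ) (w : TotalSpace F E) :
    Φ.hemisphereFlow t (poincareProj w) = poincareProj (Φ.toFlow t w) := by
  apply Subtype.ext
  simp only [hemisphereFlow, poincareProj]
  rw [Φ.extFlow_extScale, extScale_inv_extNorm_extScale (inv_pos.2 (extNorm_one_pos w))]
  rfl

/-- In polar coordinates `(v, s) ↦ exp s • v` the linear flow is a skew product over the flow on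
the sphere bundle. -/
lemma toFlow_scale_exp (t s : ℝ) (v : SphereBundle F E) :
    Φ.toFlow t (scale (Real.exp s) v.1) =
      scale (Real.exp (s + Real.log (fiberNorm (Φ.toFlow t v.1)))) (Φ.sphereFlow t v).1 := by
  have h : 0 < fiberNorm (Φ.toFlow t v.1) := Φ.fiberNorm_pos t v.1 (v.2.symm ▸ one_pos)
  simp only [sphereFlow]
  rw [Φ.map_scale, scale_scale, Real.exp_add, Real.exp_log h, mul_inv_cancel_right₀ h.ne']

end LinearFlow

/-! ### Polar coordinates on the hemisphere -/

lemma extNorm_scale (v : SphereBundle F E) (a r : ℝ) :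
    extNorm (scale a v.1, r) = √(a ^ 2 + r ^ 2) := by
  rw [extNorm, fiberNorm_scale, v.2, mul_one, sq_abs]

/-- Polar coordinates on the closed upper hemisphere: the point with direction `v` in the sphere
bundle and polar angle `θ`, where `θ = 0` is the zero section and `θ = π / 2` the equator. -/
def polarPoint (p : SphereBundle F E × Set.Icc (0 : ℝ) (Real.pi / 2)) :
    ClosedUpperHemisphere F E :=
  ⟨(scale (Real.sin p.2) p.1.1, Real.cos p.2),
    by rw [extNorm_scale, Real.sin_sq_add_cos_sq, Real.sqrt_one],
    Real.cos_nonneg_of_mem_Icc ⟨by linarith [p.2.2.1, Real.pi_pos], p.2.2.2⟩⟩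

lemma poincareProj_scale_eq_polarPoint (v : SphereBundle F E) {a : ℝ} (ha : 0 < a) :
    poincareProj (scale a v.1) = polarPoint (v, ⟨Real.arctan a,
      (Real.arctan_pos.2 ha).le, (Real.arctan_lt_pi_div_two a).le⟩) := by
  apply Subtype.ext
  simp only [poincareProj, polarPoint, extNorm_scale, extScale, scale_scale, Real.sin_arctan,
    Real.cos_arctan, one_pow, add_comm (a ^ 2), mul_one, one_div]
  rw [div_eq_inv_mul]

end Flows

/-! ### Continuity and uniform continuity -/

section FlowContinuity

variable {B : Type*} [TopologicalSpace B]
  {F : Type*} [NormedAddCommGroup F] [InnerProductSpace ℝ F]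
  {E : B → Type*} [TopologicalSpace (TotalSpace F E)]
  [∀ b, NormedAddCommGroup (E b)] [∀ b, InnerProductSpace ℝ (E b)]
  [FiberBundle F E] [VectorBundle ℝ F E] [IsContinuousRiemannianBundle F E]

namespace LinearFlow

variable (Φ : LinearFlow F E)

lemma continuous_fiberNorm_toFlow (t : ℝ) :
    Continuous fun v : SphereBundle F E => fiberNorm (Φ.toFlow t v.1) :=
  (continuous_fiberNorm F E).comp (Φ.toFlow.continuous continuous_const continuous_subtype_val)

lemma continuous_log_fiberNorm_toFlow (t : ℝ) :
    Continuous fun v : SphereBundle F E => Real.log (fiberNorm (Φ.toFlow t v.1)) :=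
  (Φ.continuous_fiberNorm_toFlow t).log
    fun v => (Φ.fiberNorm_pos t v.1 (v.2.symm ▸ one_pos)).ne'

lemma continuous_sphereFlow (t : ℝ) : Continuous (Φ.sphereFlow t) :=
  (continuous_scale
    ((Φ.continuous_fiberNorm_toFlow t).inv₀
      fun v => (Φ.fiberNorm_pos t v.1 (v.2.symm ▸ one_pos)).ne')
    (Φ.toFlow.continuous continuous_const continuous_subtype_val)).subtype_mk _

lemma continuous_hemisphereFlow (t : ℝ) : Continuous (Φ.hemisphereFlow t) := by
  have h : Continuous fun p : ClosedUpperHemisphere F E => Φ.extFlow t p.1 :=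
    (Φ.toFlow.continuous continuous_const continuous_subtype_val.fst).prodMk
      continuous_subtype_val.snd
  exact (continuous_extScale (((continuous_extNorm F E).comp h).inv₀
    fun p => (Φ.extNorm_extFlow_pos t p).ne') h).subtype_mk _

end LinearFlow

omit [IsContinuousRiemannianBundle F E] in
lemma continuous_polarPoint : Continuous (polarPoint (F := F) (E := E)) :=
  ((continuous_scale (Real.continuous_sin.comp (continuous_subtype_val.comp continuous_snd))
    (continuous_subtype_val.comp continuous_fst)).prodMk
    (Real.continuous_cos.comp (continuous_subtype_val.comp continuous_snd))).subtype_mk _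

/-- Although `exp` is not uniformly continuous, its composition with `arctan` is. -/
lemma abs_arctan_exp_sub_le (s s' : ℝ) :
    |Real.arctan (Real.exp s) - Real.arctan (Real.exp s')| ≤ |s - s'| := by
  have h := Convex.norm_image_sub_le_of_norm_hasDerivWithin_le
    (f := fun x => Real.arctan (Real.exp x)) (C := 1) (s := Set.univ) (x := s') (y := s)
    (fun x _ => ((Real.hasDerivAt_exp x).arctan).hasDerivWithinAt) ?_ convex_univ
    (Set.mem_univ _) (Set.mem_univ _)
  · simpa using h
  · intro x _
    have h0 := Real.exp_pos x
    rw [Real.norm_of_nonneg (by positivity), one_div, inv_mul_le_iff₀ (by positivity)]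
    nlinarith [sq_nonneg (Real.exp x - 1)]

/-- The polar parametrization `(v, s) ↦ π_P (exp s • v)` of the open hemisphere minus the zero
section is uniformly continuous, as it factors through a compact space. -/
lemma exists_dist_poincareProj_lt [CompactSpace B] [FiniteDimensional ℝ F]
    (dS : CompatibleMetric (SphereBundle F E)) (dP : CompatibleMetric (ClosedUpperHemisphere F E))
    {ε : ℝ} (hε : 0 < ε) :
    ∃ δ > 0, ∀ (v v' : SphereBundle F E) (s s' : ℝ), dS.dist v v' < δ → |s - s'| < δ →
      dP.dist (poincareProj (scale (Real.exp s) v.1)) (poincareProj (scale (Real.exp s') v'.1))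
        < ε := by
  obtain ⟨δ, hδ, h⟩ := dS.exists_dist_lt_of_continuous dP continuous_polarPoint hε
  refine ⟨δ, hδ, fun v v' s s' hv hs => ?_⟩
  rw [poincareProj_scale_eq_polarPoint v (Real.exp_pos s),
    poincareProj_scale_eq_polarPoint v' (Real.exp_pos s')]
  exact h _ _ _ _ hv ((abs_arctan_exp_sub_le s s').trans_lt hs)

end FlowContinuity

/-! ### Growth of chains and the Morse spectrum -/

section Spectrum

variable {B : Type*} {F : Type*} {E : B → Type*} [TopologicalSpace (TotalSpace F E)]
  [∀ b, NormedAddCommGroup (E b)] [∀ b, InnerProductSpace ℝ (E b)] {Φ : LinearFlow F E}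
  {dS : CompatibleMetric (SphereBundle F E)} {M : Set (SphereBundle F E)}

/-- A nonzero element `l` of the Morse spectrum gives chains in `M` whose growth has the sign of
`l` and is as large as desired, since their total time tends to infinity. -/
lemma LinearFlow.exists_skewReach_of_mem_morseSpectrum {l : ℝ} (hl : l ∈ Φ.morseSpectrum dS M)
    (hl0 : l ≠ 0) {ε : ℝ} (hε : 0 < ε) (T R : ℝ) :
    ∃ u ∈ M, ∃ u' ∈ M, ∃ a, R ≤ a * l ∧ SkewReach dS Φ.sphereFlow
      (fun t v => Real.log (fiberNorm (Φ.toFlow t v.1))) ε T 0 u u' a := by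
  obtain ⟨e, τ, ζ, -, hτ0, he, hτ, hζ, hlim⟩ := hl
  have hl2 : 0 < l ^ 2 := by positivity
  have hlim' : Tendsto (fun k => Φ.growthRate (ζ k) * l) atTop (𝓝 (l ^ 2)) := by
    rw [pow_two]
    exact hlim.mul_const l
  obtain ⟨k, hke, hkT, hkR, hkl⟩ := ((he.eventually (gt_mem_nhds hε)).and
    ((hτ.eventually_ge_atTop T).and ((hτ.eventually_ge_atTop (|R| / (l ^ 2 / 2))).and
    (hlim'.eventually (lt_mem_nhds (half_lt_self hl2)))))).exists
  refine ⟨_, hζ k 0 (Nat.zero_le _), _, hζ k _ le_rfl, _, ?_,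
    (ζ k).skewReach.mono hke.le hkT le_rfl⟩
  have hσ : τ k ≤ (ζ k).totalTime := by
    have h1 : ∀ i ∈ Finset.range (ζ k).n, τ k ≤ (ζ k).time i :=
      fun i hi => (ζ k).time_ge i (Finset.mem_range.1 hi)
    exact (h1 0 (Finset.mem_range.2 (ζ k).n_pos)).trans
      (Finset.single_le_sum (f := (ζ k).time) (fun i hi => (hτ0 k).le.trans (h1 i hi))
        (Finset.mem_range.2 (ζ k).n_pos))
  have hσ0 := (hτ0 k).trans_le hσ
  have hlog : ∀ i, Real.log (fiberNorm ((ζ k).pt i).1) = 0 := fun i => by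
    rw [((ζ k).pt i).2, Real.log_one]
  simp only [LinearFlow.growthRate, hlog, sub_zero] at hkl
  set G := ∑ i ∈ Finset.range (ζ k).n, Real.log (fiberNorm (Φ.toFlow ((ζ k).time i) ((ζ k).pt i).1))
  have h1 : l ^ 2 / 2 * (ζ k).totalTime < G * l := by
    rw [← lt_div_iff₀ hσ0]
    convert hkl using 1
    ring
  have h2 : |R| ≤ τ k * (l ^ 2 / 2) := (div_le_iff₀ (by positivity)).1 hkR
  nlinarith [le_abs_self R, mul_le_mul_of_nonneg_right hσ (half_pos hl2).le]

end Spectrum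

end PoincareBundle
end

open PoincareBundle
theorem theorem4 {B : Type*} [MetricSpace B] [CompactSpace B]
    {F : Type*} [NormedAddCommGroup F] [InnerProductSpace ℝ F] [FiniteDimensional ℝ F]
    {E : B → Type*} [TopologicalSpace (TotalSpace F E)]
    [∀ b, NormedAddCommGroup (E b)] [∀ b, InnerProductSpace ℝ (E b)]
    [FiberBundle F E] [VectorBundle ℝ F E] [IsContinuousRiemannianBundle F E]
    (Φ : LinearFlow F E)
    (dS : CompatibleMetric (SphereBundle F E))
    (dP : CompatibleMetric (ClosedUpperHemisphere F E))
    (M : Set (SphereBundle F E))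
    (hM : IsChainRecurrentComponent dS Φ.sphereFlow M)
    (h0 : (0 : ℝ) ∈ interior (Φ.morseSpectrum dS M)) :
    IsChainTransitive dP Φ.hemisphereFlow (closure (poincareProj '' coneBundle M)) := by
  refine IsChainTransitive.closure Φ.continuous_hemisphereFlow Φ.hemisphereFlow_add ?_
  rintro _ ⟨_, ⟨α, hα, v, hv, rfl⟩, rfl⟩ _ ⟨_, ⟨β, hβ, w, hw, rfl⟩, rfl⟩
  rw [mem_chainLimitSet_iff]
  intro ε hε T hT
  obtain ⟨δ, hδ, hδε⟩ := exists_dist_poincareProj_lt dS dP hε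
  obtain ⟨r, hr, hrS⟩ := Metric.mem_nhds_iff.1 (mem_interior_iff_mem_nhds.1 h0)
  have hpos : r / 2 ∈ Φ.morseSpectrum dS M := hrS (by
    rw [mem_ball_zero_iff, Real.norm_eq_abs, abs_of_pos (half_pos hr)]; linarith)
  have hneg : -(r / 2) ∈ Φ.morseSpectrum dS M := hrS (by
    rw [mem_ball_zero_iff, norm_neg, Real.norm_eq_abs, abs_of_pos (half_pos hr)]; linarith)
  -- The loops over `M` supply exactly the growth from `exp s = α` to `exp s' = β`.
  have hreach := hM.prop.skewReach Φ.continuous_sphereFlow Φ.sphereFlow_add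
    Φ.continuous_log_fiberNorm_toFlow hδ hT (half_pos hδ)
    (fun R => by
      obtain ⟨u, hu, u', hu', a, ha, h⟩ := LinearFlow.exists_skewReach_of_mem_morseSpectrum hpos
        (half_pos hr).ne' hδ T (R * (r / 2))
      exact ⟨u, hu, u', hu', a, le_of_mul_le_mul_right ha (half_pos hr), h⟩)
    (fun R => by
      obtain ⟨u, hu, u', hu', a, ha, h⟩ := LinearFlow.exists_skewReach_of_mem_morseSpectrum hneg
        (neg_neg_of_pos (half_pos hr)).ne hδ T (R * -(r / 2))
      exact ⟨u, hu, u', hu', a, le_of_mul_le_mul_right (by linarith) (half_pos hr), h⟩)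
    hv hw (Real.log β - Real.log α) (Real.log α)
  have hle : SkewStep dS Φ.sphereFlow (fun t v => Real.log (fiberNorm (Φ.toFlow t v.1))) δ T (δ / 2)
      ≤ Function.onFun (ChainStep dP Φ.hemisphereFlow ε T) fun p : SphereBundle F E × ℝ =>
        poincareProj (scale (Real.exp p.2) p.1.1) := by
    rintro p q ⟨t, ht, hd, hs⟩
    refine ⟨t, ht, ?_⟩
    rw [Φ.hemisphereFlow_poincareProj, Φ.toFlow_scale_exp]
    refine hδε _ _ _ _ hd ?_
    rw [abs_sub_comm]
    exact hs.trans_lt (half_lt_self hδ)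
  have := Relation.TransGen.lift _ hle _ _ hreach
  simpa [Function.onFun, Real.exp_log hα, Real.exp_log hβ] using this
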